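/- **Setting.** Let $\Phi$ be a finite (reduced, crystallographic) root system in a Euclidean space $\mathfrak E$ with simple roots $\{\alpha_i\}_{i\in I}$, coroots $\alpha^\vee$, simple reflections $s_i$ and Cartan matrix $M=(\langle\alpha_i,\alpha_j^\vee\rangle)_{i,j\in I}$. For $J\subseteq I$ let $\Phi_J$ be the root subsystem with simple roots $\{\alpha_j\}_{j\in J}$, let $\omega_j^J=\sum_{k\in J}((M^J)^{-1})_{jk}\,\alpha_k$ ($j\in J$) be its fundamental weights, where $M^J=(M_{jk})_{j,k\in J}$, let $\Lambda_{\Phi_J}$ be their $\mathbb Z$-span and $\Lambda_{\Phi_J}^+$ the set of their nonnegative integral combinations, put $\varrho^J=\sum_{j\in J}\omega_j^J$, and let $W_J$ be the group generated by $\{s_j\}_{j\in J}$. The $\Phi_J$-Weyl bialternant of $\lambda\in\Lambda^+_{\Phi_J}$ is $$\chi^{\Phi_J}_\lambda=\frac{\sum_{w\in W_J}\det(w)\,e^{w(\lambda+\varrho^J)}}{\sum_{w\in W_J}\det(w)\,e^{w(\varrho^J)}}.$$ Let $R$ be a finite ranked poset whose Hasse diagram edges (covering relations) are colored by $I$; write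 $x\xrightarrow{i}y$ for an edge of color $i$ from $x$ up to $y$. For $i\in I$ let $\mathbf{comp}_i(x)$ be the connected component of $x$ in the graph formed by the edges of color $i$, regarded as the poset with this component as its Hasse diagram; let $\rho_i(x)$ be the rank of $x$ in $\mathbf{comp}_i(x)$, $l_i(x)$ the length of $\mathbf{comp}_i(x)$, $\delta_i(x)=l_i(x)-\rho_i(x)$ and $m_i(x)=\rho_i(x)-\delta_i(x)$. Put $wt^J(x)=\sum_{j\in J}m_j(x)\,\omega_j^J$, and $\mathsf{WGF}(R)|_J=\sum_{x\in R}e^{wt^J(x)}$. Say $R$ is $M_{\Phi_J}$-structured if $wt^J(x)+\alpha_i=wt^J(y)$ whenever $x\xrightarrow{i}y$ with $i\in J$ (and $M_\Phi$-structured if this holds for $J=I$). For $\nu\in\Lambda_{\Phi_J}^+$ and $\mathcal S\subseteq R$, the pair $(R,\mathcal S)$ is a $(J,\nu)$-splitting poset if $R$ is $M_\Phi$-structured, $\nu+wt^J(s)\in\Lambda^+_{\Phi_J}$ for all $s\in\mathcal S$, and $$\chi^{\Phi_J}_\nu\cdot\mathsf{WGF}(R)|_J=\sum_{s\in\mathcal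 S}\chi^{\Phi_J}_{\nu+wt^J(s)}.\qquad(*)$$ For $d\ge1$, the $d$-sub-block of a product $\mathcal C_1\times\cdots\times\mathcal C_p$ of finite chains is the set of all $(x_1,\dots,x_p)$ such that, for the $q$ with $\sum_{r>q}(|\mathcal C_r|-1)<d\le\sum_{r\ge q}(|\mathcal C_r|-1)$, the elements $x_{q+1},\dots,x_p$ are minimal and $x_q$ has depth at least $d-\sum_{r>q}(|\mathcal C_r|-1)$ in $\mathcal C_q$; it is empty if there is no such $q$. If $\phi$ is a poset isomorphism from a product of chains onto a poset $Q$, the image of the $d$-sub-block under $\phi$ is a $d$-sub-block of $Q$. A sub-face is a $1$-sub-block. **Theorem.** Let $J\subseteq I$, let $\nu=\sum_{j\in J}\nu_j\omega_j^J\in\Lambda^+_{\Phi_J}$, and let $R$ be $M_{\Phi_J}$-structured. (0) If for every $j\in J$ all $j$-components of $R$ are rank symmetric, then $\mathsf{WGF}(R)|_J$ is $W_J$-invariant. Now suppose that $\mathsf{WGF}(R)|_J$ is $W_J$-invariant, let $\mathcal S\subseteq\{x\in R:\delta_j(x)\le\nu_j\text{ for all }j\in J\}$, let $\kappa:R\setminus\mathcal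 S\to J$ be a function, and for $x\in R\setminus\mathcal S$ let $\mathsf K(x)=\{y\in\mathbf{comp}_{\kappa(x)}(x): y\notin\mathcal S,\ \kappa(y)=\kappa(x)\}$, a subposet of $\mathbf{comp}_{\kappa(x)}(x)$ in the induced order. (1) Suppose that for each $x\in R\setminus\mathcal S$, with $k=\kappa(x)$, the restriction of $\rho_k$ to $\mathsf K(x)$ is a rank function with range $\{0,1,\dots,l_k(x)-(\nu_k+1)\}$, and $\mathsf K(x)$ has a symmetric chain decomposition that includes a chain of length $l_k(x)-(\nu_k+1)$. Then $\nu+wt^J(s)\in\Lambda^+_{\Phi_J}$ for all $s\in\mathcal S$, and $(*)$ holds; in particular $(R,\mathcal S)$ is a $(J,\nu)$-splitting poset if $R$ is $M_\Phi$-structured. (2) Suppose that for each $x\in R\setminus\mathcal S$, with $k=\kappa(x)$, the poset $\mathbf{comp}_k(x)$ is isomorphic to a product of chains and $\mathsf K(x)$ is a $(\nu_k+1)$-sub-block of it. Then the conclusions of (1) hold. (3) Suppose that $J=I$ and $\nu=0$, and that for each $x\in R\setminus\mathcal S$ the poset $\mathbf{comp}_{\kappa(x)}(x)$ is isomorphic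 to a product of chains and $\mathsf K(x)$ is a sub-face of it. Then $wt^J(s)\in\Lambda^+_{\Phi_J}$ for all $s\in\mathcal S$, $(R,\mathcal S)$ is a $(J,0)$-splitting poset, and $\mathsf{WGF}(R)|_J=\sum_{s\in\mathcal S}\chi^{\Phi_J}_{wt^J(s)}$. -/

import Mathlib

namespace SplittingPoset

noncomputable section

/-- The group ring `ℤ[V]` of a real vector space is an integral domain, so that quotients of its
elements may be formed in its field of fractions. -/
instance groupRing_isDomain (V : Type*) [AddCommGroup V] [Module ℝ V] :
    IsDomain (AddMonoidAlgebra ℤ V) := by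
  let _ : Module ℚ V := Module.compHom V (algebraMap ℚ ℝ)
  have : NoZeroDivisors (AddMonoidAlgebra ℤ V) := inferInstance
  exact NoZeroDivisors.to_isDomain _

section RootSystems

variable {ι V N : Type*} [AddCommGroup V] [Module ℝ V] [AddCommGroup N] [Module ℝ N]
  {P : RootPairing ι ℝ V N} (b : P.Base) (J : Finset b.support)

/-- The minor `M^J` of the Cartan matrix: the rows and columns indexed by `J`, with entries
`M_{jk} = ⟨α_j, α_k^∨⟩`. The simple roots are the `P.root i` with `i : b.support`, so `b.support` is
the index set `I`, and `J` is a subset of it. -/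
def cartanMinor : Matrix J J ℝ :=
  Matrix.of fun j k => P.pairing (j : b.support) (k : b.support)

open Classical in
/-- The fundamental weight `ω_j^J = ∑_{k ∈ J} ((M^J)⁻¹)_{jk} α_k` of the root subsystem `Φ_J`.
It is characterised by `coroot_fundWeight` below. -/
def fundWeight (j : J) : V :=
  ∑ k : J, (cartanMinor b J)⁻¹ j k • P.root (k : b.support)

/-- The dominant weights `Λ_{Φ_J}^+`: nonnegative integral combinations of the `ω_j^J`. -/
def dominantWeights : Set V :=
  {v | ∃ n : J → ℕ, v = ∑ j : J, (n j : ℝ) • fundWeight b J j}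

/-- The subgroup `W_J` of the Weyl group, generated by the simple reflections `s_j`, `j ∈ J`. It acts
on the whole space and fixes the orthogonal complement of the span of `Φ_J` pointwise; restriction
to that span identifies it (determinants included) with the Weyl group of `Φ_J`. -/
def weylSubgroup : Subgroup (V ≃ₗ[ℝ] V) :=
  Subgroup.closure (Set.range fun j : J => P.reflection (j : b.support))

theorem weylSubgroup_image_root (w : V ≃ₗ[ℝ] V) (hw : w ∈ weylSubgroup b J) (i : ι) :
    w (P.root i) ∈ Set.range P.root := by
  induction hw using Subgroup.closure_induction'' generalizing i with
  | one => exact ⟨i, rfl⟩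
  | mem x hx =>
    obtain ⟨j, rfl⟩ := hx
    exact ⟨_, P.root_reflectionPerm _ i⟩
  | inv_mem x hx =>
    obtain ⟨j, rfl⟩ := hx
    simp only [RootPairing.reflection_inv]
    exact ⟨_, P.root_reflectionPerm _ i⟩
  | mul x y _ _ hx hy =>
    obtain ⟨k, hk⟩ := hy i
    obtain ⟨l, hl⟩ := hx k
    exact ⟨l, by rw [hl, hk]; rfl⟩

theorem two_mul_rootForm [Fintype ι] (v : V) (i : ι) :
    2 * P.RootForm v (P.root i) = P.coroot' i v * P.RootForm (P.root i) (P.root i) := by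
  have h := P.rootForm_reflection_reflection_apply i v (P.root i)
  rw [P.reflection_apply_self, P.reflection_apply] at h
  simp at h
  simp 
  linarith

variable [Finite ι] [P.IsRootSystem]

instance weylSubgroup_finite : Finite (weylSubgroup b J) := by
  refine Finite.of_injective
    (fun w : weylSubgroup b J => fun i : ι => (weylSubgroup_image_root b J w w.2 i).choose) ?_
  intro w w' h
  apply Subtype.ext
  apply LinearEquiv.toLinearMap_injective
  refine LinearMap.ext_on_range (RootPairing.IsRootSystem.span_root_eq_top (P := P)) fun i => ?_
  have h1 := (weylSubgroup_image_root b J w w.2 i).choose_spec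
  have h2 := (weylSubgroup_image_root b J w' w'.2 i).choose_spec
  have h3 := congrFun h i
  simp only at h3
  rw [h3] at h1
  simpa using h1.symm.trans h2

instance weylSubgroup_fintype : Fintype (weylSubgroup b J) := Fintype.ofFinite _

/-- The inverse in `fundWeight` is a genuine one. -/
theorem cartanMinor_det_ne_zero [DecidableEq b.support] : (cartanMinor b J).det ≠ 0 := by
  classical
  have := Fintype.ofFinite ι
  intro h
  obtain ⟨c, hc0, hc⟩ := Matrix.exists_vecMul_eq_zero_iff.mpr h
  set u : V := ∑ j : J, c j • P.root (j : b.support) with hu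
  have h1 : ∀ k : J, P.coroot' (k : b.support) u = 0 := by
    intro k
    have := congrFun hc k
    simpa [hu, Matrix.vecMul, dotProduct, cartanMinor] using this
  have h2 : P.RootForm u u = 0 := by
    conv_lhs => rw [hu]
    rw [← hu, hu, map_sum]
    refine Finset.sum_eq_zero fun k _ => ?_
    have := two_mul_rootForm (P := P) u (k : b.support)
    rw [h1 k] at this
    rw [← hu, map_smul]
    have h3 : P.RootForm u (P.root (k : b.support)) = 0 := by linarith
    rw [h3]; simp
  have h3 : ∀ i, P.coroot' i u = 0 := by
    rw [RootPairing.rootForm_apply_apply] at h2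
    intro i
    have := (Finset.sum_eq_zero_iff_of_nonneg (fun i _ => mul_self_nonneg _)).mp h2 i
      (Finset.mem_univ _)
    simpa using this
  have h4 : u = 0 := by
    refine P.rootForm_nondegenerate.1 u fun y => ?_
    rw [RootPairing.rootForm_apply_apply]
    simp [h3]
  have hli : LinearIndependent ℝ (fun j : J => P.root (j : b.support)) := by
    have := b.linearIndepOn_root
    exact LinearIndependent.comp this (fun j : J => (⟨j.1.1, j.1.2⟩ : (b.support : Set ι)))
      (fun x y hxy => Subtype.ext (Subtype.ext (congrArg (fun z : (b.support : Set ι) => (z : ι)) hxy)))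
  have := Fintype.linearIndependent_iff.mp hli c h4
  exact hc0 (funext this)

/-- The fundamental weights of `Φ_J` are dual to the simple coroots of `Φ_J`. -/
theorem coroot_fundWeight (j k : J) [Decidable (j = k)] :
    P.coroot' (k : b.support) (fundWeight b J j) = if j = k then 1 else 0 := by
  classical
  have h : (cartanMinor b J)⁻¹ * cartanMinor b J = 1 :=
    Matrix.nonsing_inv_mul _ (isUnit_iff_ne_zero.mpr (cartanMinor_det_ne_zero b J))
  have := congrFun (congrFun h j) k
  rw [Matrix.mul_apply, Matrix.one_apply] at this
  simp only [fundWeight, map_sum, map_smul, RootPairing.root_coroot'_eq_pairing, smul_eq_mul]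
  refine Eq.trans ?_ (this.trans ?_)
  · rfl
  · split_ifs <;> rfl

/-- `det(w)` as an integer, for `w ∈ W_J`; it is `1` or `-1`, so it agrees with its sign
(see `weylDet_cast`). -/
def weylDet {J : Finset b.support} (w : weylSubgroup b J) : ℤ :=
  (SignType.sign (LinearMap.det ((w : V ≃ₗ[ℝ] V) : V →ₗ[ℝ] V)) : ℤ)

theorem det_reflection (i : ι) : LinearMap.det (P.reflection i : V →ₗ[ℝ] V) = -1 := by
  have h : (P.reflection i : V →ₗ[ℝ] V) = LinearMap.transvection (-P.coroot' i) (P.root i) := by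
    ext x
    simp [P.reflection_apply, LinearMap.transvection, sub_eq_add_neg]
  have : Module.Finite ℝ V :=
    ⟨Submodule.fg_def.mpr ⟨_, Set.finite_range P.root, RootPairing.IsRootSystem.span_root_eq_top⟩⟩
  rw [h, LinearMap.transvection.det]
  simp
  norm_num

theorem weylDet_cast {J : Finset b.support} (w : weylSubgroup b J) :
    (weylDet b w : ℝ) = LinearMap.det ((w : V ≃ₗ[ℝ] V) : V →ₗ[ℝ] V) := by
  have key : LinearMap.det ((w : V ≃ₗ[ℝ] V) : V →ₗ[ℝ] V) = 1 ∨
      LinearMap.det ((w : V ≃ₗ[ℝ] V) : V →ₗ[ℝ] V) = -1 := by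
    obtain ⟨w, hw⟩ := w
    induction hw using Subgroup.closure_induction'' with
    | one => left; exact LinearMap.det_id
    | mem x hx =>
      obtain ⟨j, rfl⟩ := hx
      right; exact det_reflection (P := P) _
    | inv_mem x hx =>
      obtain ⟨j, rfl⟩ := hx
      right
      simp only [RootPairing.reflection_inv]
      exact det_reflection (P := P) _
    | mul x y _ _ hx hy =>
      have : LinearMap.det ((x * y : V ≃ₗ[ℝ] V) : V →ₗ[ℝ] V)
          = LinearMap.det (x : V →ₗ[ℝ] V) * LinearMap.det (y : V →ₗ[ℝ] V) := by
        rw [← LinearMap.det_comp]; rfl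
      simp only at hx hy ⊢
      rw [this]
      rcases hx with hx | hx <;> rcases hy with hy | hy <;> rw [hx, hy] <;> simp
  unfold weylDet
  rcases key with h | h <;> rw [h] <;> simp

/-- `ϱ^J = ∑_{j ∈ J} ω_j^J`. -/
def weylVector : V := ∑ j : J, fundWeight b J j

/-- The Weyl alternant `𝒜(e^v) = ∑_{w ∈ W_J} det(w) e^{w(v)}`. The group ring of the lattice
`Λ_{Φ_J}` is regarded as a subring of the group ring `ℤ[V]` of the ambient space. -/
def alternant (v : V) : AddMonoidAlgebra ℤ V :=
  ∑ w : weylSubgroup b J, AddMonoidAlgebra.single ((w : V ≃ₗ[ℝ] V) v) (weylDet b w)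

theorem coroot_weylVector (k : J) : P.coroot' (k : b.support) (weylVector b J) = 1 := by
  classical
  rw [weylVector, map_sum, Finset.sum_eq_single k]
  · rw [coroot_fundWeight, if_pos rfl]
  · intro j _ hj
    rw [coroot_fundWeight, if_neg hj]
  · exact fun h => absurd (Finset.mem_univ _) h

theorem weyl_fix [DecidableEq b.support] (w : weylSubgroup b J) :
    (w : V ≃ₗ[ℝ] V) (weylVector b Finset.univ) - weylVector b Finset.univ
      = (w : V ≃ₗ[ℝ] V) (weylVector b J) - weylVector b J := by
  obtain ⟨w, hw⟩ := w
  simp only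
  have key : w (weylVector b Finset.univ - weylVector b J)
      = weylVector b Finset.univ - weylVector b J := by
    have base : ∀ j : J, P.reflection (j : b.support)
        (weylVector b Finset.univ - weylVector b J)
        = weylVector b Finset.univ - weylVector b J := by
      intro j
      rw [P.reflection_apply, map_sub, coroot_weylVector b J j,
        coroot_weylVector b Finset.univ ⟨j, Finset.mem_univ _⟩]
      simp
    induction hw using Subgroup.closure_induction'' with
    | one => rfl
    | mem x hx =>
      obtain ⟨j, rfl⟩ := hx
      exact base j
    | inv_mem x hx =>
      obtain ⟨j, rfl⟩ := hx
      simp only [RootPairing.reflection_inv]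
      exact base j
    | mul x y _ _ hx hy =>
      rw [LinearEquiv.mul_apply, hy, hx]
  rw [map_sub] at key
  rw [sub_eq_sub_iff_sub_eq_sub, key]

variable [P.IsCrystallographic] [P.IsReduced]

/-- The denominator `𝒜(e^ϱ)` of the Weyl bialternants does not vanish. -/
theorem alternant_weylVector_ne_zero : alternant b J (weylVector b J) ≠ 0 := by
  classical
  have := Fintype.ofFinite ι
  set p : V := weylVector b Finset.univ with hp
  let S : Finset ι := Finset.univ.filter fun i => b.IsPos i
  let F : V → ℝ := fun v => ∏ i ∈ S, P.RootForm v (P.root i)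
  have hpos : ∀ i, b.IsPos i → 0 < P.RootForm p (P.root i) := by
    have hs : ∀ i ∈ b.support, 0 < P.RootForm p (P.root i) := by
      intro i hi
      have h1 := two_mul_rootForm (P := P) p i
      rw [coroot_weylVector b Finset.univ ⟨⟨i, hi⟩, Finset.mem_univ _⟩, one_mul] at h1
      have h2 : 0 < P.RootForm (P.root i) (P.root i) := by
        rw [P.rootForm_root_self]
        refine Finset.sum_pos' (fun _ _ => mul_self_nonneg _) ⟨i, Finset.mem_univ _, by simp⟩
      linarith
    intro i hi
    refine hi.induction_on_add hs ?_
    intro i j k hk hi hj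
    rw [hk, map_add]
    exact add_pos hi (hs j hj)
  have hF : 0 < F p := Finset.prod_pos fun i hi => hpos i (Finset.mem_filter.mp hi).2
  have hrefl : ∀ (j : b.support) (v : V), F (P.reflection j v) = - F v := by
    intro j v
    have hj : b.IsPos (j : ι) := b.isPos_of_mem_support j.2
    have h1 : ∀ i, P.RootForm (P.reflection j v) (P.root i)
        = P.RootForm v (P.root (P.reflectionPerm j i)) := by
      intro i
      rw [← P.rootForm_reflection_reflection_apply j v, P.root_reflectionPerm,
        P.reflection_same]
    simp only [F]
    have hmem : (j : ι) ∈ S := Finset.mem_filter.mpr ⟨Finset.mem_univ _, hj⟩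
    rw [← Finset.mul_prod_erase _ _ hmem, ← Finset.mul_prod_erase _ (fun i : ι =>
      P.RootForm v (P.root i)) hmem]
    have h2 : P.RootForm (P.reflection j v) (P.root j) = - P.RootForm v (P.root j) := by
      rw [h1, P.root_reflectionPerm, P.reflection_apply_self, map_neg]
    rw [h2, neg_mul]
    congr 2
    have hm : ∀ i ∈ S.erase (j : ι), P.reflectionPerm j i ∈ S.erase (j : ι) := by
      intro i hi
      have hij : i ≠ j := (Finset.mem_erase.mp hi).1
      have hpi : b.IsPos i := (Finset.mem_filter.mp (Finset.mem_erase.mp hi).2).2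
      have hpi' := hpi.reflectionPerm j.2 hij
      refine Finset.mem_erase.mpr ⟨fun h => ?_, Finset.mem_filter.mpr ⟨Finset.mem_univ _, hpi'⟩⟩
      have h3 : b.height (i : ι) = - b.height (j : ι) := by
        have h4 : i = P.reflectionPerm j j := by
          rw [← P.reflectionPerm_self j i, h]
        rw [h4]
        exact b.height_reflectionPerm_self j
      have h4 := b.isPos_iff.mp hpi
      have h5 := b.isPos_iff.mp hj
      omega
    exact Finset.prod_nbij' (P.reflectionPerm j) (P.reflectionPerm j) hm hm
      (fun i _ => P.reflectionPerm_self j i) (fun i _ => P.reflectionPerm_self j i)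
      (fun i _ => h1 i)
  have hdet : ∀ (w : weylSubgroup b J) (v : V), F ((w : V ≃ₗ[ℝ] V) v) = weylDet b w * F v := by
    intro w
    rw [weylDet_cast]
    obtain ⟨w, hw⟩ := w
    simp only
    induction hw using Subgroup.closure_induction'' with
    | one => 
      intro v
      have : LinearMap.det ((1 : V ≃ₗ[ℝ] V) : V →ₗ[ℝ] V) = 1 := LinearMap.det_id
      rw [this, one_mul]; rfl
    | mem x hx =>
      obtain ⟨j, rfl⟩ := hx
      intro v
      rw [hrefl, det_reflection]; ring
    | inv_mem x hx =>
      obtain ⟨j, rfl⟩ := hx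
      intro v
      simp only [RootPairing.reflection_inv]
      rw [hrefl, det_reflection]; ring
    | mul x y _ _ hx hy =>
      intro v
      have : LinearMap.det ((x * y : V ≃ₗ[ℝ] V) : V →ₗ[ℝ] V)
          = LinearMap.det (x : V →ₗ[ℝ] V) * LinearMap.det (y : V →ₗ[ℝ] V) := by
        rw [← LinearMap.det_comp]; rfl
      rw [this, LinearEquiv.mul_apply, hx, hy]; ring
  have hstab : ∀ w : weylSubgroup b J, (w : V ≃ₗ[ℝ] V) (weylVector b J) = weylVector b J →
      weylDet b w = 1 := by
    intro w hw
    have h1 := weyl_fix b J w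
    rw [hw, sub_self, sub_eq_zero] at h1
    have h2 := hdet w p
    rw [h1] at h2
    have h3 : (weylDet b w : ℝ) = 1 := by
      have : ((weylDet b w : ℝ) - 1) * F p = 0 := by linarith
      rcases mul_eq_zero.mp this with h | h
      · linarith
      · exact absurd h hF.ne'
    exact_mod_cast h3
  intro h0
  have h1 : (alternant b J (weylVector b J)).coeff (weylVector b J) = 0 := by rw [h0]; rfl
  have h2 : (alternant b J (weylVector b J)).coeff (weylVector b J)
      = ∑ w : weylSubgroup b J,
        if (w : V ≃ₗ[ℝ] V) (weylVector b J) = weylVector b J then 1 else 0 := by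
    rw [alternant, AddMonoidAlgebra.coeff_sum, Finsupp.finsetSum_apply]
    refine Finset.sum_congr rfl fun w _ => ?_
    rw [AddMonoidAlgebra.coeff_single, Finsupp.single_apply]
    split_ifs with h
    · exact hstab w h
    · rfl
  rw [h2] at h1
  have h3 := (Finset.sum_eq_zero_iff_of_nonneg (fun w _ => by split_ifs <;> norm_num)).mp h1 1
    (Finset.mem_univ _)
  simp at h3

end RootSystems

/-- A ranked poset whose Hasse diagram edges (the covering relations) are colored by `I`. The rank
function `rank` is one witness that the poset is ranked; nothing below depends on which one. -/
structure ColoredRankedPoset (I R : Type*) [PartialOrder R] where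
  edgeColor : {e : R × R // e.1 ⋖ e.2} → I
  rank : R → ℕ
  length : ℕ
  range_rank : Set.range rank = Set.Iic length
  rank_covBy : ∀ x y : R, x ⋖ y → rank x + 1 = rank y

namespace ColoredRankedPoset

variable {I R : Type*} [PartialOrder R] (C : ColoredRankedPoset I R)

/-- There is an edge of color `i` from `x` up to `y`. -/
def Edge (i : I) (x y : R) : Prop :=
  ∃ h : x ⋖ y, C.edgeColor ⟨(x, y), h⟩ = i

/-- The `i`-component of `x`: its connected component when only edges of color `i` are kept. -/
def comp (i : I) (x : R) : Set R :=
  {y | Relation.EqvGen (C.Edge i) x y}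

/-- The order of the `i`-components, i.e. the one with the edges of color `i` as Hasse diagram. -/
def le (i : I) (x y : R) : Prop :=
  Relation.ReflTransGen (C.Edge i) x y

/-- The strict order of the `i`-components. -/
def lt (i : I) (x y : R) : Prop :=
  Relation.TransGen (C.Edge i) x y

/-- `ρ_i(x)`, the rank of `x` within its `i`-component. The component is connected, so its
only rank function is the translate of `rank` with minimum `0`. -/
def compRank (i : I) (x : R) : ℕ :=
  C.rank x - sInf (C.rank '' C.comp i x)

/-- `l_i(x)`, the length of the `i`-component of `x`. -/
def compLength (i : I) (x : R) : ℕ :=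
  sSup (C.rank '' C.comp i x) - sInf (C.rank '' C.comp i x)

/-- `δ_i(x) = l_i(x) - ρ_i(x)`, the depth of `x` in its `i`-component. -/
def compDepth (i : I) (x : R) : ℕ :=
  C.compLength i x - C.compRank i x

/-- `m_i(x) = ρ_i(x) - δ_i(x) = 2 ρ_i(x) - l_i(x)`. -/
def m (i : I) (x : R) : ℤ :=
  (C.compRank i x : ℤ) - (C.compDepth i x : ℤ)

/-- All `i`-components are rank symmetric. -/
def RankSymmetricComps (i : I) : Prop :=
  ∀ x : R, ∀ r ≤ C.compLength i x,
    {y ∈ C.comp i x | C.compRank i y = r}.ncard =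
      {y ∈ C.comp i x | C.compRank i y = C.compLength i x - r}.ncard

/-- `ρ` restricts to a rank function with range `{0, 1, …, l}` on the set `T`, which is regarded as a
subposet, in the induced order, of an `i`-component. -/
def IsRankFunctionOn (i : I) (T : Set R) (ρ : R → ℕ) (l : ℕ) : Prop :=
  ρ '' T = Set.Iic l ∧
    ∀ y ∈ T, ∀ z ∈ T, C.lt i y z → (∀ u ∈ T, ¬ (C.lt i y u ∧ C.lt i u z)) → ρ y + 1 = ρ z

/-- The length of a finite nonempty chain: its number of elements minus one. -/
def chainLength (c : Set R) : ℕ :=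
  c.ncard - 1

/-- `c` is a symmetric chain, for the rank function `ρ` and the total length `l`: a chain with
minimal element `a` and maximal element `z` such that `ρ(z) + ρ(a) = l` and `ρ(z) - ρ(a)` is
the length of `c`. -/
def IsSymmetricChain (i : I) (ρ : R → ℕ) (l : ℕ) (c : Set R) : Prop :=
  (∀ y ∈ c, ∀ z ∈ c, C.le i y z ∨ C.le i z y) ∧
    ∃ a ∈ c, ∃ z ∈ c, (∀ y ∈ c, C.le i a y ∧ C.le i y z) ∧
      ρ z + ρ a = l ∧ ρ z = ρ a + chainLength c

/-- `chains` is a symmetric chain decomposition of the subposet `T` of an `i`-component, where `T` is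
ranked by `ρ` and has length `l`. -/
def IsSCD (i : I) (T : Set R) (ρ : R → ℕ) (l : ℕ) (chains : Set (Set R)) : Prop :=
  chains.PairwiseDisjoint id ∧ ⋃₀ chains = T ∧ ∀ c ∈ chains, C.IsSymmetricChain i ρ l c

/-- The `d`-sub-block (`d ≥ 1`) of the product of the chains `{0 < 1 < ⋯ < len r}`, `r : Fin p`. Such a
chain has `len r + 1` elements, and its element `t` has depth `len r - t`. The set is empty if `d`
exceeds the sum of all `len r`. -/
def subBlock {p : ℕ} (len : Fin p → ℕ) (d : ℕ) : Set ((r : Fin p) → Fin (len r + 1)) :=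
  {x | ∃ q : Fin p, ∑ r ∈ Finset.Ioi q, len r < d ∧ d ≤ ∑ r ∈ Finset.Ici q, len r ∧
    (∀ r, q < r → x r = 0) ∧ d - ∑ r ∈ Finset.Ioi q, len r ≤ len q - (x q : ℕ)}

/-- The `i`-component of `x` is isomorphic, as a poset, to a product of chains, by an isomorphism
under which `T` corresponds to the `d`-sub-block. -/
def IsSubBlock (i : I) (x : R) (d : ℕ) (T : Set R) : Prop :=
  T ⊆ C.comp i x ∧
    ∃ (p : ℕ) (len : Fin p → ℕ) (φ : ((r : Fin p) → Fin (len r + 1)) ≃ {y // y ∈ C.comp i x}),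
      (∀ u v, u ≤ v ↔ C.le i (φ u) (φ v)) ∧ ∀ u, (φ u : R) ∈ T ↔ u ∈ subBlock len d

/-- A sub-face is a `1`-sub-block. -/
def IsSubFace (i : I) (x : R) (T : Set R) : Prop :=
  C.IsSubBlock i x 1 T

/-- `K(x)`: the elements of the `κ(x)`-component of `x` that lie outside `S` and are given the same
color as `x` by the vertex-coloring `κ`. -/
def sameColored {J : Finset I} {S : Finset R} (κ : {x // x ∉ S} → J) (x : {x // x ∉ S}) : Set R :=
  {y | y ∈ C.comp (κ x) x ∧ ∃ hy : y ∉ S, κ ⟨y, hy⟩ = κ x}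

end ColoredRankedPoset

section Splitting

variable {ι V N : Type*} [AddCommGroup V] [Module ℝ V] [AddCommGroup N] [Module ℝ N]
  {P : RootPairing ι ℝ V N} (b : P.Base)
  {R : Type*} [PartialOrder R] (C : ColoredRankedPoset b.support R)

/-- The `J`-weight `wt^J(x) = ∑_{j ∈ J} m_j(x) ω_j^J`. -/
def wt (J : Finset b.support) (x : R) : V :=
  ∑ j : J, (C.m j x : ℝ) • fundWeight b J j

/-- `R` is `M_{Φ_J}`-structured: `wt^J(x) + α_i = wt^J(y)` whenever there is an edge of color `i ∈ J`
from `x` to `y`. For `J = I` this says that `R` is `M_Φ`-structured. -/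
def IsStructured (J : Finset b.support) : Prop :=
  ∀ i ∈ J, ∀ x y : R, C.Edge i x y → wt b C J x + P.root i = wt b C J y

/-- The weight generating function `WGF(R) = ∑_x e^{wt(x)}`. -/
def wgf [Fintype R] : AddMonoidAlgebra ℤ V :=
  ∑ x : R, AddMonoidAlgebra.single (wt b C Finset.univ x) 1

/-- The projection `v ↦ v^J = ∑_{j ∈ J} ⟨v, α_j^∨⟩ ω_j^J` onto the span of `Φ_J`. -/
def proj (J : Finset b.support) (v : V) : V :=
  ∑ j : J, P.coroot' (j : b.support) v • fundWeight b J j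

/-- The restriction `χ|_J`, obtained by replacing each `e^μ` by `e^{μ^J}`. -/
def restrict (J : Finset b.support) (f : AddMonoidAlgebra ℤ V) : AddMonoidAlgebra ℤ V :=
  AddMonoidAlgebra.mapDomain (proj b J) f

/-- `f` is `W_J`-invariant, for the action `w.e^μ = e^{w(μ)}`. -/
def IsWeylInvariant (J : Finset b.support) (f : AddMonoidAlgebra ℤ V) : Prop :=
  ∀ w ∈ weylSubgroup b J, AddMonoidAlgebra.mapDomain w f = f

variable [Finite ι] [P.IsRootSystem]

/-- The `Φ_J`-Weyl bialternant `χ_v = 𝒜(e^{v + ϱ}) / 𝒜(e^ϱ)`, in the field of fractions of the group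
ring. The denominator is nonzero by `alternant_weylVector_ne_zero`. -/
def bialternant (J : Finset b.support) (v : V) : FractionRing (AddMonoidAlgebra ℤ V) :=
  algebraMap (AddMonoidAlgebra ℤ V) _ (alternant b J (v + weylVector b J)) /
    algebraMap (AddMonoidAlgebra ℤ V) _ (alternant b J (weylVector b J))

/-- The weight generating function `WGF(R)|_J` as an element of the field of fractions. -/
def wgfRestrict [Fintype R] (J : Finset b.support) : FractionRing (AddMonoidAlgebra ℤ V) :=
  algebraMap (AddMonoidAlgebra ℤ V) _ (restrict b J (wgf b C))

/-- `R`, together with the set `S`, is a `(J,ν)`-splitting poset: `R` is `M_Φ`-structured, the weights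
`ν + wt^J(s)` are dominant, and `χ_ν · WGF(R)|_J = ∑_{s ∈ S} χ_{ν + wt^J(s)}`. -/
structure IsRefinedSplitting [Fintype R] (J : Finset b.support) (ν : V) (S : Finset R) : Prop where
  structured : IsStructured b C Finset.univ
  dominant : ∀ s ∈ S, ν + wt b C J s ∈ dominantWeights b J
  identity : bialternant b J ν * wgfRestrict b C J = ∑ s ∈ S, bialternant b J (ν + wt b C J s)

end Splitting

end

end SplittingPoset

open SplittingPoset

/-!
Write `ϱ` for `ϱ^J`, `𝒜(v)` for the alternant `∑ w, det(w) e^{w(v)}` over `w ∈ W_J`, and `s_k` for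
a simple reflection.

In an `M_{Φ_J}`-structured poset the weights along a `k`-component, `k ∈ J`, differ by multiples of
`α_k`, and `⟨wt^J(x), α_k^∨⟩ = m_k(x) = 2 ρ_k(x) - l_k(x)`. So for any `v` with `⟨v, α_k^∨⟩ = c`, the
reflection `s_k` sends `v + wt^J(y)` to `v + wt^J(z)` whenever `y` and `z` are in the same
`k`-component and `ρ_k(y) + ρ_k(z) = l_k - c` (`IsStructured.reflection_add_wt`).

For `v = 0` this shows that `WGF(R)|_J` is invariant if the components are rank symmetric. If it is
invariant, multiplying it by an alternant gives `𝒜(ν + ϱ) · WGF(R)|_J = ∑ x, 𝒜(ν + wt^J(x) + ϱ)`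
(`alternant_mul`), so the identity amounts to the vanishing of the sum of the terms with `x ∉ S`
(`sum_alternant_compl_eq_zero`). The sets `K(x)` partition the complement of `S`. On `K(x)`, with
`k = κ(x)`, the above is applied to `v = ν + ϱ` and `c = ν_k + 1`: if `K(x)` admits a bijection to
itself which turns the rank `r` into `l_k(x) - (ν_k + 1) - r`, then it matches alternants with
their negatives, since `𝒜(s_k v) = -𝒜(v)`, and the sum over `K(x)` is equal to its own negative.

Such a bijection (`IsRankReversible`) exists in both cases that are needed: a symmetric chain can be
turned upside down (`IsSCD.isRankReversible`), and a `d`-sub-block of a product of chains is itself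
a product of chains, of total length smaller by `d` (`IsSubBlock.isRankReversible`).
-/

namespace SplittingPoset

noncomputable section

/-! ### Sets with a rank-reversing self-bijection -/

/-- A set `T` is rank reversible about `L`, for the function `ρ`, if some injective self-map `σ` of `T`
satisfies `ρ y + ρ (σ y) = L` for all `y ∈ T`. For a finite `T` this says that all values of `ρ` on
`T` are at most `L` and that `r` and `L - r` are attained equally often. -/
def IsRankReversible {α : Type*} (T : Set α) (ρ : α → ℕ) (L : ℕ) : Prop :=
  ∃ σ : α → α, Set.MapsTo σ T T ∧ Set.InjOn σ T ∧ ∀ y ∈ T, ρ y + ρ (σ y) = L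

section RankReversible

variable {α M : Type*} {ρ : α → ℕ} {L : ℕ}

theorem IsRankReversible.sum_eq [AddCommMonoid M] {T : Finset α}
    (hT : IsRankReversible (T : Set α) ρ L) {f g : α → M}
    (hfg : ∀ y ∈ T, ∀ z ∈ T, ρ y + ρ z = L → f y = g z) : ∑ y ∈ T, f y = ∑ y ∈ T, g y := by
  obtain ⟨σ, hmaps, hinj, hρ⟩ := hT
  exact Finset.sum_nbij σ (fun y hy => hmaps hy) hinj
    (Finset.surjOn_of_injOn_of_card_le σ hmaps hinj le_rfl)
    fun y hy => hfg y hy _ (hmaps hy) (hρ y hy)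

theorem IsRankReversible.of_ncard_eq [Finite α] {T : Set α} (hle : ∀ y ∈ T, ρ y ≤ L)
    (hcard : ∀ r ≤ L, {y ∈ T | ρ y = r}.ncard = {y ∈ T | ρ y = L - r}.ncard) :
    IsRankReversible T ρ L := by
  classical
  have key : ∀ r, Nonempty ({y : T // ρ y = r} ≃ {y : T // L - ρ y = r}) := by
    intro r
    by_cases hr : r ≤ L
    · have e1 : {y : T // ρ y = r} ≃ {y ∈ T | ρ y = r} :=
        Equiv.subtypeSubtypeEquivSubtypeInter (· ∈ T) (fun y => ρ y = r)
      have e2 : {y : T // L - ρ y = r} ≃ {y ∈ T | ρ y = L - r} :=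
        (Equiv.subtypeEquivRight fun y => by
          have := hle y y.2
          omega).trans
          (Equiv.subtypeSubtypeEquivSubtypeInter (· ∈ T) (fun y => ρ y = L - r))
      have e3 : {y ∈ T | ρ y = r} ≃ {y ∈ T | ρ y = L - r} := by
        refine Classical.choice (Finite.card_eq.mp ?_)
        have := hcard r hr
        rwa [← Nat.card_coe_set_eq, ← Nat.card_coe_set_eq] at this
      exact ⟨e1.trans (e3.trans e2.symm)⟩
    · have : IsEmpty {y : T // ρ y = r} := ⟨fun y => hr (y.2 ▸ hle y.1 y.1.2)⟩
      have : IsEmpty {y : T // L - ρ y = r} := ⟨fun y => by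
        have := y.2
        omega⟩
      exact ⟨Equiv.equivOfIsEmpty _ _⟩
  let e : T ≃ T :=
    Equiv.ofFiberEquiv (f := fun y : T => ρ y) (g := fun y : T => L - ρ y) fun r => (key r).some
  have he : ∀ y : T, L - ρ (e y) = ρ y := fun y =>
    Equiv.ofFiberEquiv_map (f := fun y : T => ρ y) (g := fun y : T => L - ρ y)
      (fun r => (key r).some) y
  refine ⟨fun y => if h : y ∈ T then e ⟨y, h⟩ else y, fun y hy => ?_, fun y hy z hz h => ?_,
    fun y hy => ?_⟩
  · simp [hy]
  · simp only [hy, hz, dif_pos] at h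
    simpa using e.injective (Subtype.ext h)
  · have h1 := he ⟨y, hy⟩
    have h2 := hle _ (e ⟨y, hy⟩).2
    simp only [hy, dif_pos] at h1 ⊢
    omega

/-- A sum over a finite type may be evaluated on the classes of the relation `key x = key y`. -/
theorem sum_eq_sum_of_fibers {β : Type*} [Fintype α] [AddCommMonoid M] (key : α → β)
    {f g : α → M} (h : ∀ x, ∀ T : Finset α, (∀ y, y ∈ T ↔ key y = key x) →
      ∑ y ∈ T, f y = ∑ y ∈ T, g y) : ∑ x, f x = ∑ x, g x := by
  classical
  have hmaps : ∀ x ∈ (Finset.univ : Finset α), key x ∈ Finset.univ.image key :=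
    fun x hx => Finset.mem_image_of_mem _ hx
  rw [← Finset.sum_fiberwise_of_maps_to hmaps f, ← Finset.sum_fiberwise_of_maps_to hmaps g]
  refine Finset.sum_congr rfl fun c hc => ?_
  obtain ⟨x, -, rfl⟩ := Finset.mem_image.mp hc
  exact h x _ fun y => by simp

end RankReversible

/-! ### Ranks in the components of a colored poset -/

namespace ColoredRankedPoset

variable {I R : Type*} [PartialOrder R] (C : ColoredRankedPoset I R) {i : I} {x y : R}

theorem mem_comp_self (i : I) (x : R) : x ∈ C.comp i x :=
  .refl x

variable {C}

theorem comp_eq_of_mem (h : y ∈ C.comp i x) : C.comp i y = C.comp i x :=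
  Set.ext fun _ => ⟨fun hz => .trans _ _ _ h hz, fun hz => .trans _ _ _ (.symm _ _ h) hz⟩

theorem comp_eq_iff : C.comp i y = C.comp i x ↔ y ∈ C.comp i x :=
  ⟨fun h => h ▸ C.mem_comp_self i y, comp_eq_of_mem⟩

theorem Edge.rank_eq (h : C.Edge i x y) : C.rank x + 1 = C.rank y :=
  C.rank_covBy x y h.1

theorem mem_comp_of_le (h : C.le i x y) : y ∈ C.comp i x := by
  induction h with
  | refl => exact .refl x
  | tail _ hbc ih => exact .trans _ _ _ ih (.rel _ _ hbc)

theorem rank_le_of_le (h : C.le i x y) : C.rank x ≤ C.rank y := by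
  induction h with
  | refl => exact le_rfl
  | tail _ hbc ih => have := hbc.rank_eq; omega

theorem eq_of_le_of_rank_le (h : C.le i x y) (hr : C.rank y ≤ C.rank x) : x = y := by
  rcases Relation.ReflTransGen.cases_head h with h | ⟨z, hxz, hzy⟩
  · exact h
  · have := hxz.rank_eq
    have := rank_le_of_le hzy
    omega

variable (C)

theorem rank_le_length (x : R) : C.rank x ≤ C.length := by
  have : C.rank x ∈ Set.range C.rank := ⟨x, rfl⟩
  rwa [C.range_rank] at this

theorem bddAbove_rank_image (T : Set R) : BddAbove (C.rank '' T) :=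
  ⟨C.length, by rintro _ ⟨y, -, rfl⟩; exact C.rank_le_length y⟩

theorem compRank_add (i : I) (x : R) :
    C.compRank i x + sInf (C.rank '' C.comp i x) = C.rank x :=
  Nat.sub_add_cancel (Nat.sInf_le ⟨x, C.mem_comp_self i x, rfl⟩)

theorem compRank_le_compLength (i : I) (x : R) : C.compRank i x ≤ C.compLength i x :=
  Nat.sub_le_sub_right (le_csSup (C.bddAbove_rank_image _) ⟨x, C.mem_comp_self i x, rfl⟩) _

theorem m_eq (i : I) (x : R) : C.m i x = 2 * C.compRank i x - C.compLength i x := by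
  have := C.compRank_le_compLength i x
  simp only [m, compDepth]
  omega

variable {C}

theorem compLength_eq (h : y ∈ C.comp i x) : C.compLength i y = C.compLength i x := by
  rw [compLength, compLength, comp_eq_of_mem h]

theorem compRank_add_of_mem (h : y ∈ C.comp i x) :
    C.compRank i y + sInf (C.rank '' C.comp i x) = C.rank y := by
  rw [← comp_eq_of_mem h, compRank_add]

theorem compRank_add_rank (h : y ∈ C.comp i x) :
    C.compRank i y + C.rank x = C.compRank i x + C.rank y := by
  have := compRank_add_of_mem h
  have := C.compRank_add i x
  omega

theorem exists_mem_comp_compRank_eq_compLength (i : I) (x : R) :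
    ∃ y ∈ C.comp i x, C.compRank i y = C.compLength i x := by
  obtain ⟨y, hy, h⟩ := Nat.sSup_mem (s := C.rank '' C.comp i x)
    ⟨_, x, C.mem_comp_self i x, rfl⟩ (C.bddAbove_rank_image _)
  refine ⟨y, hy, ?_⟩
  rw [compRank, compLength, comp_eq_of_mem hy, h]

theorem exists_mem_comp_compRank_eq_zero (i : I) (x : R) :
    ∃ y ∈ C.comp i x, C.compRank i y = 0 := by
  obtain ⟨y, hy, h⟩ := Nat.sInf_mem (s := C.rank '' C.comp i x)
    ⟨_, x, C.mem_comp_self i x, rfl⟩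
  refine ⟨y, hy, ?_⟩
  rw [compRank, comp_eq_of_mem hy, h, Nat.sub_self]

theorem RankSymmetricComps.isRankReversible [Finite R] (h : C.RankSymmetricComps i) (x : R) :
    IsRankReversible (C.comp i x) (C.compRank i) (C.compLength i x) :=
  .of_ncard_eq (fun y hy => compLength_eq hy ▸ C.compRank_le_compLength i y) (h x)

/-! ### Symmetric chain decompositions -/

/-- A symmetric chain meets each rank between those of its ends exactly once; hence it is closed
under the reflection of ranks. -/
theorem IsSymmetricChain.exists_rank_add_eq [Finite R] {l : ℕ} {c : Set R}
    (hc : C.IsSymmetricChain i (C.compRank i) l c) (hy : y ∈ c) :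
    ∃ z ∈ c, C.compRank i y + C.compRank i z = l := by
  obtain ⟨hch, a, ha, z, hz, haz, hsum, hlen⟩ := hc
  have hmem : ∀ u ∈ c, u ∈ C.comp i a := fun u hu => mem_comp_of_le (haz u hu).1
  have hrk : ∀ u ∈ c, C.compRank i u + sInf (C.rank '' C.comp i a) = C.rank u :=
    fun u hu => compRank_add_of_mem (hmem u hu)
  have hinj : Set.InjOn (C.compRank i) c := by
    intro u hu v hv huv
    have hu' := hrk u hu
    have hv' := hrk v hv
    rcases hch u hu v hv with h | h
    · exact eq_of_le_of_rank_le h (by omega)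
    · exact (eq_of_le_of_rank_le h (by omega)).symm
  have hIcc : ∀ u ∈ c, C.compRank i u ∈ Set.Icc (C.compRank i a) (C.compRank i z) := by
    intro u hu
    have h1 := rank_le_of_le (haz u hu).1
    have h2 := rank_le_of_le (haz u hu).2
    have := hrk u hu
    have := hrk a ha
    have := hrk z hz
    constructor <;> omega
  have himg : C.compRank i '' c = Set.Icc (C.compRank i a) (C.compRank i z) := by
    refine Set.eq_of_subset_of_ncard_le (Set.image_subset_iff.mpr hIcc) ?_ (Set.finite_Icc _ _)
    have hpos : 0 < c.ncard := (Set.ncard_pos (Set.toFinite c)).mpr ⟨a, ha⟩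
    rw [hinj.ncard_image, Set.ncard_eq_toFinset_card', Set.toFinset_Icc, Nat.card_Icc]
    unfold chainLength at hlen
    omega
  have hyI := hIcc y hy
  have : l - C.compRank i y ∈ C.compRank i '' c := by
    rw [himg]
    constructor <;> have := hyI.1 <;> have := hyI.2 <;> omega
  obtain ⟨u, hu, hru⟩ := this
  refine ⟨u, hu, ?_⟩
  have := hyI.2
  omega

theorem IsSCD.isRankReversible [Finite R] {T : Set R} {l : ℕ} {chains : Set (Set R)}
    (h : C.IsSCD i T (C.compRank i) l chains) (hT : T ⊆ C.comp i x) :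
    IsRankReversible T (C.compRank i) l := by
  classical
  obtain ⟨hdisj, hunion, hsym⟩ := h
  have key : ∀ y : R, ∃ z, y ∈ T →
      ∃ c ∈ chains, y ∈ c ∧ z ∈ c ∧ C.compRank i y + C.compRank i z = l := by
    intro y
    by_cases hy : y ∈ T
    · rw [← hunion] at hy
      obtain ⟨c, hc, hyc⟩ := hy
      obtain ⟨z, hz, hyz⟩ := (hsym c hc).exists_rank_add_eq hyc
      exact ⟨z, fun _ => ⟨c, hc, hyc, hz, hyz⟩⟩
    · exact ⟨y, fun h => absurd h hy⟩
  choose σ hσ using key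
  refine ⟨σ, fun y hy => ?_, fun y hy z hz hyz => ?_, fun y hy => ?_⟩
  · obtain ⟨c, hc, -, h, -⟩ := hσ y hy
    exact hunion ▸ ⟨c, hc, h⟩
  · obtain ⟨c, hc, hyc, hyc', hy'⟩ := hσ y hy
    obtain ⟨d, hd, hzd, hzd', hz'⟩ := hσ z hz
    have hcd : c = d := by
      by_contra hne
      exact Set.disjoint_left.mp (hdisj hc hd hne) hyc' (hyz ▸ hzd')
    subst hcd
    have hy1 := compRank_add_of_mem (hT hy)
    have hz1 := compRank_add_of_mem (hT hz)
    rw [hyz] at hy'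
    rcases (hsym c hc).1 y hyc z hzd with h | h
    · exact eq_of_le_of_rank_le h (by omega)
    · exact (eq_of_le_of_rank_le h (by omega)).symm
  · obtain ⟨c, -, -, -, h⟩ := hσ y hy
    exact h

/-! ### Sub-blocks of chain products -/

section ChainProduct

variable {p : ℕ} {len : Fin p → ℕ}

/-- The reflection of ranks on a sub-block: a `d`-sub-block is a product of chains, of total length
`∑ r, len r - d`, and every chain is turned upside down. -/
theorem subBlock_isRankReversible {d : ℕ} (hne : (subBlock len d).Nonempty) :
    ∃ L, L + d = ∑ r, len r ∧
      IsRankReversible (subBlock len d) (fun u => ∑ r, (u r : ℕ)) L := by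
  classical
  obtain ⟨u₀, q, hq1, hq2, -, -⟩ := hne
  set t := ∑ r ∈ Finset.Ioi q, len r with ht
  have hIci : ∑ r ∈ Finset.Ici q, len r = len q + t := by
    rw [ht, ← Finset.Ioi_insert, Finset.sum_insert (by simp)]
  rw [hIci] at hq2
  -- the sub-block as a product of chains of lengths `cap r`
  let cap : Fin p → ℕ := fun r => if r < q then len r else if r = q then len q - (d - t) else 0
  have hcap : ∀ r, cap r ≤ len r := by
    intro r
    simp only [cap]
    split_ifs with h1 h2
    · exact le_rfl
    · exact h2 ▸ Nat.sub_le _ _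
    · exact Nat.zero_le _
  have hmem : ∀ u : (r : Fin p) → Fin (len r + 1), u ∈ subBlock len d ↔ ∀ r, (u r : ℕ) ≤ cap r := by
    intro u
    constructor
    · rintro ⟨q', h1, h2, h3, h4⟩ r
      -- the partial sums determine `q`
      have hqq : q' = q := by
        rcases lt_trichotomy q' q with h | h | h
        · have : ∑ r ∈ Finset.Ici q, len r ≤ ∑ r ∈ Finset.Ioi q', len r :=
            Finset.sum_le_sum_of_subset fun r hr =>
              Finset.mem_Ioi.mpr (h.trans_le (Finset.mem_Ici.mp hr))
          omega
        · exact h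
        · have : ∑ r ∈ Finset.Ici q', len r ≤ ∑ r ∈ Finset.Ioi q, len r :=
            Finset.sum_le_sum_of_subset fun r hr =>
              Finset.mem_Ioi.mpr (h.trans_le (Finset.mem_Ici.mp hr))
          omega
      subst hqq
      simp only [cap]
      split_ifs with h5 h6
      · have := (u r).2
        omega
      · subst h6
        rw [← ht] at h4
        have := (u r).2
        omega
      · have : q' < r := lt_of_le_of_ne (not_lt.mp h5) (Ne.symm h6)
        simp [h3 r this]
    · intro h
      refine ⟨q, hq1, by rw [hIci]; exact hq2, fun r hr => ?_, ?_⟩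
      · have := h r
        simp only [cap, not_lt.mpr hr.le, hr.ne', if_false] at this
        exact Fin.ext (by simpa using this)
      · have := h q
        simp only [cap, lt_irrefl, if_false, if_true] at this
        rw [← ht]
        omega
  have hsum : ∑ r, cap r + d = ∑ r, len r := by
    have hsplit : ∀ f : Fin p → ℕ,
        ∑ r, f r = ∑ r ∈ Finset.Iio q, f r + (f q + ∑ r ∈ Finset.Ioi q, f r) := by
      intro f
      rw [← Finset.sum_insert (s := Finset.Ioi q) (by simp), Finset.Ioi_insert,
        ← Finset.sum_union]
      · congr 1
        ext r
        simpa using lt_or_ge r q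
      · rw [Finset.disjoint_left]
        intro r hr hr'
        exact absurd (Finset.mem_Iio.mp hr) (not_lt.mpr (Finset.mem_Ici.mp hr'))
    rw [hsplit cap, hsplit len, ← ht]
    have h1 : ∑ r ∈ Finset.Iio q, cap r = ∑ r ∈ Finset.Iio q, len r :=
      Finset.sum_congr rfl fun r hr => if_pos (Finset.mem_Iio.mp hr)
    have h2 : ∑ r ∈ Finset.Ioi q, cap r = 0 := by
      refine Finset.sum_eq_zero fun r hr => ?_
      have hr := Finset.mem_Ioi.mp hr
      simp [cap, hr.ne', not_lt.mpr hr.le]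
    have h3 : cap q = len q - (d - t) := by simp [cap]
    omega
  refine ⟨∑ r, cap r, hsum,
    fun u r => ⟨cap r - u r, by have := hcap r; omega⟩, fun u hu => ?_, fun u hu v hv huv => ?_,
    fun u hu => ?_⟩
  · exact (hmem _).mpr fun r => Nat.sub_le _ _
  · funext r
    have h1 := (hmem u).mp hu r
    have h2 := (hmem v).mp hv r
    have h3 := congrArg Fin.val (congrFun huv r)
    simp only at h3
    exact Fin.ext (by omega)
  · rw [← Finset.sum_add_distrib]
    exact Finset.sum_congr rfl fun r _ => Nat.add_sub_cancel' ((hmem u).mp hu r)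

variable {φ : ((r : Fin p) → Fin (len r + 1)) ≃ {y // y ∈ C.comp i x}}

/-- An isomorphism from a product of chains onto a component preserves ranks. -/
theorem compRank_chainProduct (hφ : ∀ u v, u ≤ v ↔ C.le i (φ u) (φ v))
    (u : (r : Fin p) → Fin (len r + 1)) : C.compRank i (φ u) = ∑ r, (u r : ℕ) := by
  classical
  have hmem : ∀ u, (φ u : R) ∈ C.comp i x := fun u => (φ u).2
  have hrank : ∀ n : ℕ, ∀ u : (r : Fin p) → Fin (len r + 1), ∑ r, (u r : ℕ) = n →
      C.rank (φ u) = C.rank (φ 0) + n := by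
    intro n
    induction n with
    | zero =>
      intro u hu
      have : u = 0 := by
        funext r
        exact Fin.ext (by simpa using (Finset.sum_eq_zero_iff.mp hu) r (Finset.mem_univ r))
      rw [this, add_zero]
    | succ n ih =>
      intro u hu
      obtain ⟨s, hs⟩ : ∃ s, (u s : ℕ) ≠ 0 := by
        by_contra! h
        simp [h] at hu
      -- `v` is covered by `u`
      let v : (r : Fin p) → Fin (len r + 1) :=
        Function.update u s ⟨u s - 1, by have := (u s).2; omega⟩
      have hvs : (v s : ℕ) = u s - 1 := by simp [v]
      have hvr : ∀ r, r ≠ s → v r = u r := fun r hr => by simp [v, hr]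
      have hvn : ∑ r, (v r : ℕ) = n := by
        rw [← Finset.add_sum_erase _ _ (Finset.mem_univ s)] at hu ⊢
        rw [hvs, Finset.sum_congr rfl fun r hr => by rw [hvr r (Finset.ne_of_mem_erase hr)]]
        omega
      have hvu : v ≤ u := by
        intro r
        by_cases hr : r = s
        · subst hr
          exact Fin.le_def.mpr (by omega)
        · rw [hvr r hr]
      have hedge : C.Edge i (φ v) (φ u) := by
        rcases Relation.ReflTransGen.cases_head ((hφ v u).mp hvu) with h | ⟨z, hvz, hzu⟩
        · have : v = u := φ.injective (Subtype.ext h)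
          rw [this] at hvs
          omega
        · have hz : z ∈ C.comp i x := .trans _ _ _ (hmem v) (.rel _ _ hvz)
          obtain ⟨w, hw⟩ := φ.surjective ⟨z, hz⟩
          have hwz : (φ w : R) = z := congrArg Subtype.val hw
          rw [← hwz] at hvz hzu
          have h1 : v ≤ w := (hφ v w).mpr (.single hvz)
          have h2 : w ≤ u := (hφ w u).mpr hzu
          have h3 : v ≠ w := fun h => by
            have := hvz.rank_eq
            rw [h] at this
            omega
          have h4 : w = u := by
            funext r
            by_cases hr : r = s
            · subst hr
              have h5 : v r ≠ w r := fun h => h3 <| by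
                funext r'
                by_cases hr' : r' = r
                · exact hr' ▸ h
                · exact le_antisymm (h1 r') ((h2 r').trans (hvr r' hr').ge)
              have h6 := Fin.lt_def.mp (lt_of_le_of_ne (h1 r) h5)
              have h7 := Fin.le_def.mp (h2 r)
              exact Fin.ext (by omega)
            · exact le_antisymm (h2 r) ((hvr r hr).ge.trans (h1 r))
          rwa [h4] at hvz
      have := hedge.rank_eq
      have := ih v hvn
      omega
  have h0 : C.compRank i (φ 0) = 0 := by
    obtain ⟨y, hy, hy0⟩ := C.exists_mem_comp_compRank_eq_zero i x
    obtain ⟨w, hw⟩ := φ.surjective ⟨y, hy⟩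
    have hwy : (φ w : R) = y := congrArg Subtype.val hw
    have h1 := rank_le_of_le ((hφ 0 w).mp fun r => Fin.zero_le _)
    rw [hwy] at h1
    have h2 := compRank_add_of_mem hy
    have h3 := compRank_add_of_mem (hmem 0)
    omega
  have h1 := hrank _ u rfl
  have h2 := compRank_add_of_mem (hmem 0)
  have h3 := compRank_add_of_mem (hmem u)
  omega

theorem compLength_chainProduct (hφ : ∀ u v, u ≤ v ↔ C.le i (φ u) (φ v)) :
    C.compLength i x = ∑ r, len r := by
  apply le_antisymm
  · obtain ⟨y, hy, h⟩ := C.exists_mem_comp_compRank_eq_compLength i x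
    obtain ⟨w, hw⟩ := φ.surjective ⟨y, hy⟩
    have hwy : (φ w : R) = y := congrArg Subtype.val hw
    rw [← h, ← hwy, compRank_chainProduct hφ]
    exact Finset.sum_le_sum fun r _ => Nat.lt_succ_iff.mp (w r).2
  · have h1 := compRank_chainProduct hφ fun r => Fin.last (len r)
    have h2 := C.compRank_le_compLength i (φ fun r => Fin.last (len r))
    rw [compLength_eq (φ _).2, h1] at h2
    simpa using h2

end ChainProduct

theorem IsSubBlock.isRankReversible {d : ℕ} {T : Set R} (h : C.IsSubBlock i x d T)
    (hne : T.Nonempty) :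
    ∃ L, L + d = C.compLength i x ∧ IsRankReversible T (C.compRank i) L := by
  classical
  obtain ⟨hT, p, len, φ, hφ, hφT⟩ := h
  have hpre : ∀ y (hy : y ∈ T), φ.symm ⟨y, hT hy⟩ ∈ subBlock len d := by
    intro y hy
    rw [← hφT, Equiv.apply_symm_apply]
    exact hy
  obtain ⟨y₀, hy₀⟩ := hne
  obtain ⟨L, hL, σ, hmaps, hinj, hσ⟩ := subBlock_isRankReversible ⟨_, hpre y₀ hy₀⟩
  refine ⟨L, by rw [hL, compLength_chainProduct hφ],
    fun y => if hy : y ∈ T then φ (σ (φ.symm ⟨y, hT hy⟩)) else y, fun y hy => ?_,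
    fun y hy z hz hyz => ?_, fun y hy => ?_⟩
  · simp only [hy, dif_pos]
    exact (hφT _).mpr (hmaps (hpre y hy))
  · simp only [hy, hz, dif_pos] at hyz
    have := hinj (hpre y hy) (hpre z hz) (φ.injective (Subtype.ext hyz))
    simpa using this
  · simp only [hy, dif_pos]
    have h1 := hσ _ (hpre y hy)
    simp only [← compRank_chainProduct hφ, Equiv.apply_symm_apply] at h1
    exact h1

theorem mem_sameColored_self {J : Finset I} {S : Finset R} (κ : {x // x ∉ S} → J)
    (x : {x // x ∉ S}) : (x : R) ∈ C.sameColored κ x :=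
  ⟨C.mem_comp_self _ _, x.2, rfl⟩

end ColoredRankedPoset

/-! ### Weights and reflections -/

section Weights

theorem mapDomain_sum_single {α V W : Type*} [Fintype α] (g : V → W) (u : α → V) :
    AddMonoidAlgebra.mapDomain g (∑ x, AddMonoidAlgebra.single (u x) (1 : ℤ)) =
      ∑ x, AddMonoidAlgebra.single (g (u x)) (1 : ℤ) := by
  classical
  have h : ∀ T : Finset α, AddMonoidAlgebra.mapDomain g
      (∑ x ∈ T, AddMonoidAlgebra.single (u x) (1 : ℤ)) =
        ∑ x ∈ T, AddMonoidAlgebra.single (g (u x)) (1 : ℤ) := by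
    intro T
    induction T using Finset.induction_on with
    | empty => simp
    | insert x T hx ih =>
      rw [Finset.sum_insert hx, Finset.sum_insert hx, AddMonoidAlgebra.mapDomain_add, ih,
        AddMonoidAlgebra.mapDomain_single]
  exact h Finset.univ

variable {ι V N : Type*} [AddCommGroup V] [Module ℝ V] [AddCommGroup N] [Module ℝ N]
  {P : RootPairing ι ℝ V N} {b : P.Base} {J : Finset b.support}
  {R : Type*} [PartialOrder R] {C : ColoredRankedPoset b.support R}

theorem IsStructured.wt_eq (h : IsStructured b C J) {i : b.support} (hi : i ∈ J) {x y : R}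
    (hxy : y ∈ C.comp i x) :
    wt b C J y = wt b C J x + ((C.compRank i y : ℝ) - C.compRank i x) • P.root i := by
  have key : wt b C J y = wt b C J x + ((C.rank y : ℝ) - C.rank x) • P.root i := by
    induction hxy with
    | rel x y hxy =>
      have h1 : (C.rank y : ℝ) = C.rank x + 1 := by exact_mod_cast hxy.rank_eq.symm
      rw [← h i hi x y hxy, h1, add_sub_cancel_left, one_smul]
    | refl x => simp
    | symm x y _ ih => rw [ih]; module
    | trans x y z _ _ ih₁ ih₂ => rw [ih₂, ih₁]; module
  have h1 : (C.compRank i y : ℝ) + C.rank x = C.compRank i x + C.rank y := by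
    exact_mod_cast ColoredRankedPoset.compRank_add_rank hxy
  rw [key]
  congr 2
  linarith

theorem add_wt_mem_dominantWeights {ν : V} {n : J → ℕ}
    (hν : ν = ∑ j : J, (n j : ℝ) • fundWeight b J j) {x : R}
    (hx : ∀ j : J, C.compDepth j x ≤ n j) : ν + wt b C J x ∈ dominantWeights b J := by
  refine ⟨fun j => n j - C.compDepth j x + C.compRank j x, ?_⟩
  rw [hν, wt, ← Finset.sum_add_distrib]
  refine Finset.sum_congr rfl fun j _ => ?_
  rw [← add_smul, ColoredRankedPoset.m]
  congr 1
  push_cast [Nat.cast_sub (hx j)]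
  ring

theorem isWeylInvariant_of_reflection {f : AddMonoidAlgebra ℤ V}
    (h : ∀ j : J, AddMonoidAlgebra.mapDomain (P.reflection (j : b.support)) f = f) :
    IsWeylInvariant b J f := by
  intro w hw
  induction hw using Subgroup.closure_induction'' with
  | one => ext v; simp [AddMonoidAlgebra.mapDomain]
  | mem w hw => obtain ⟨j, rfl⟩ := hw; exact h j
  | inv_mem w hw =>
    obtain ⟨j, rfl⟩ := hw
    simpa only [RootPairing.reflection_inv] using h j
  | mul w w' _ _ ih ih' =>
    have : AddMonoidAlgebra.mapDomain (w * w' : V ≃ₗ[ℝ] V) f =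
        AddMonoidAlgebra.mapDomain w (AddMonoidAlgebra.mapDomain w' f) := by
      simp only [AddMonoidAlgebra.mapDomain, LinearEquiv.mul_eq_trans]
      rw [← Finsupp.mapDomain_comp]
      rfl
    rw [this, ih', ih]

variable [Finite ι] [P.IsRootSystem] (b)

theorem coroot_sum_fundWeight (a : J → ℝ) (k : J) :
    P.coroot' (k : b.support) (∑ j : J, a j • fundWeight b J j) = a k := by
  classical
  rw [map_sum, Finset.sum_eq_single k]
  · rw [map_smul, coroot_fundWeight, if_pos rfl, smul_eq_mul, mul_one]
  · intro j _ hj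
    rw [map_smul, coroot_fundWeight, if_neg hj, smul_zero]
  · exact fun h => absurd (Finset.mem_univ _) h

theorem coroot_wt (k : J) (x : R) : P.coroot' (k : b.support) (wt b C J x) = C.m k x :=
  coroot_sum_fundWeight b (fun j => (C.m j x : ℝ)) k

theorem proj_wt_univ (x : R) : proj b J (wt b C Finset.univ x) = wt b C J x := by
  refine Finset.sum_congr rfl fun j _ => ?_
  rw [coroot_wt b ⟨(j : b.support), Finset.mem_univ _⟩]

theorem restrict_wgf [Fintype R] :
    restrict b J (wgf b C) = ∑ x : R, AddMonoidAlgebra.single (wt b C J x) (1 : ℤ) := by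
  rw [restrict, wgf, mapDomain_sum_single]
  simp only [proj_wt_univ]

variable {b}

/-- Within a `k`-component the weights lie on an `α_k`-string, so after a shift by `v` with
`⟨v, α_k^∨⟩ = c` the reflection `s_k` exchanges the weights of elements whose ranks add up to the
length minus `c`. -/
theorem IsStructured.reflection_add_wt (h : IsStructured b C J) (k : J) {v : V} {c : ℕ}
    (hv : P.coroot' (k : b.support) v = c) {x y z : R} (hy : y ∈ C.comp k x)
    (hz : z ∈ C.comp k x)
    (hyz : C.compRank k y + C.compRank k z + c = C.compLength k x) :
    P.reflection (k : b.support) (v + wt b C J y) = v + wt b C J z := by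
  have hzy : z ∈ C.comp k y := by rwa [ColoredRankedPoset.comp_eq_of_mem hy]
  rw [h.wt_eq k.2 hzy, P.reflection_apply, map_add, hv, coroot_wt, C.m_eq,
    ColoredRankedPoset.compLength_eq hy, ← hyz]
  push_cast
  module

theorem IsStructured.isWeylInvariant [Fintype R] (h : IsStructured b C J)
    (hsymm : ∀ j ∈ J, C.RankSymmetricComps j) :
    IsWeylInvariant b J (restrict b J (wgf b C)) := by
  refine isWeylInvariant_of_reflection fun j => ?_
  rw [restrict_wgf, mapDomain_sum_single]
  refine sum_eq_sum_of_fibers (C.comp (j : b.support)) fun x T hT => ?_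
  have hT' : (T : Set R) = C.comp (j : b.support) x :=
    Set.ext fun y => (hT y).trans ColoredRankedPoset.comp_eq_iff
  have hrev := (hsymm j j.2).isRankReversible x
  rw [← hT'] at hrev
  refine hrev.sum_eq fun y hy z hz hyz => ?_
  have := h.reflection_add_wt j (v := 0) (c := 0) (by simp) (hT' ▸ hy) (hT' ▸ hz) hyz
  rw [zero_add, zero_add] at this
  rw [this]

/-! ### Alternants -/

theorem weylDet_mul (w w' : weylSubgroup b J) :
    weylDet b (w * w') = weylDet b w * weylDet b w' := by
  have h : (weylDet b (w * w') : ℝ) = weylDet b w * weylDet b w' := by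
    rw [weylDet_cast, weylDet_cast, weylDet_cast, ← LinearMap.det_comp]
    rfl
  exact_mod_cast h

/-- The simple reflection `s_j` as an element of `W_J`. -/
def simpleReflection (b : P.Base) {J : Finset b.support} (j : J) : weylSubgroup b J :=
  ⟨P.reflection (j : b.support), Subgroup.subset_closure ⟨j, rfl⟩⟩

theorem weylDet_simpleReflection (j : J) : weylDet b (simpleReflection b j) = -1 := by
  have h : (weylDet b (simpleReflection b j) : ℝ) = -1 := by
    rw [weylDet_cast]
    exact det_reflection (P := P) _
  exact_mod_cast h

theorem alternant_reflection (j : J) (v : V) :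
    alternant b J (P.reflection (j : b.support) v) = -alternant b J v := by
  rw [alternant, alternant, ← Equiv.sum_comp (Equiv.mulRight (simpleReflection b j)),
    ← Finset.sum_neg_distrib]
  refine Finset.sum_congr rfl fun w _ => ?_
  have h : ((w * simpleReflection b j : weylSubgroup b J) : V ≃ₗ[ℝ] V)
      (P.reflection (j : b.support) v) = (w : V ≃ₗ[ℝ] V) v := by
    simp [simpleReflection, LinearEquiv.mul_apply]
  rw [Equiv.coe_mulRight, h, weylDet_mul, weylDet_simpleReflection, mul_neg, mul_one,
    AddMonoidAlgebra.single_neg]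

/-- Multiplying an alternant by the `W_J`-invariant `∑ x, e^{u x}` shifts it by each exponent. -/
theorem alternant_mul {α : Type*} [Fintype α] (v : V) (u : α → V)
    (h : IsWeylInvariant b J (∑ x, AddMonoidAlgebra.single (u x) (1 : ℤ))) :
    alternant b J v * ∑ x, AddMonoidAlgebra.single (u x) (1 : ℤ) =
      ∑ x, alternant b J (v + u x) := by
  simp only [alternant]
  rw [Finset.sum_mul, Finset.sum_comm]
  refine Finset.sum_congr rfl fun w _ => ?_
  have h1 := mapDomain_sum_single (w : V ≃ₗ[ℝ] V) u
  rw [h w w.2] at h1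
  rw [h1, Finset.mul_sum]
  simp [AddMonoidAlgebra.single_mul_single]

/-! ### Splitting -/

section Splitting

variable [Fintype R] {ν : V} {n : J → ℕ} {S : Finset R} {κ : {x // x ∉ S} → J}

/-- The alternants of the elements outside `S` cancel in pairs: on each set `K(x)`, the rank
reversal is realised on the weights `ν + wt^J(y) + ϱ^J` by the simple reflection `s_{κ(x)}`. -/
theorem sum_alternant_compl_eq_zero [DecidableEq R]
    (hν : ν = ∑ j : J, (n j : ℝ) • fundWeight b J j)
    (hstr : IsStructured b C J)
    (hK : ∀ x : {x // x ∉ S}, ∃ l, l + (n (κ x) + 1) = C.compLength (κ x) x ∧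
      IsRankReversible (C.sameColored κ x) (C.compRank (κ x)) l) :
    ∑ x : {x // x ∉ S}, alternant b J (ν + wt b C J x + weylVector b J) = 0 := by
  classical
  have key : ∑ x : {x // x ∉ S}, alternant b J (ν + wt b C J x + weylVector b J) =
      ∑ x : {x // x ∉ S}, -alternant b J (ν + wt b C J x + weylVector b J) := by
    -- the fibers are the sets `K(x)`
    refine sum_eq_sum_of_fibers (fun x : {x // x ∉ S} => (κ x, C.comp (κ x) x)) fun x T hT => ?_
    obtain ⟨l, hl, hrev⟩ := hK x
    have hT' : ((T.map (Function.Embedding.subtype _) : Finset R) : Set R) =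
        C.sameColored κ x := by
      ext y
      simp only [Finset.coe_map, Function.Embedding.subtype_apply, Set.mem_image,
        SetLike.mem_coe, hT, Prod.mk.injEq]
      constructor
      · rintro ⟨y, ⟨h1, h2⟩, rfl⟩
        exact ⟨ColoredRankedPoset.comp_eq_iff.mp (h1 ▸ h2), y.2, h1⟩
      · rintro ⟨h1, hy, h2⟩
        exact ⟨⟨y, hy⟩, ⟨h2, by rw [h2]; exact ColoredRankedPoset.comp_eq_of_mem h1⟩, rfl⟩
    rw [← hT'] at hrev
    have := hrev.sum_eq (f := fun y => alternant b J (ν + wt b C J y + weylVector b J))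
      (g := fun y => -alternant b J (ν + wt b C J y + weylVector b J)) fun y hy z hz hyz => ?_
    · simpa only [Finset.sum_map, Function.Embedding.subtype_apply] using this
    · have hy' : y ∈ C.sameColored κ x := hT' ▸ Finset.mem_coe.mpr hy
      have hz' : z ∈ C.sameColored κ x := hT' ▸ Finset.mem_coe.mpr hz
      have hc : P.coroot' (κ x : b.support) (ν + weylVector b J) = (n (κ x) + 1 : ℕ) := by
        rw [map_add, hν, coroot_sum_fundWeight b (fun j => (n j : ℝ)), coroot_weylVector]
        push_cast
        rfl
      have h1 := hstr.reflection_add_wt (κ x) hc hy'.1 hz'.1 (by rw [hyz, hl])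
      rw [add_right_comm, add_right_comm ν (wt b C J z), ← h1, alternant_reflection, neg_neg]
  rw [Finset.sum_neg_distrib] at key
  ext v
  have h := congrArg (fun f => f.coeff v) key
  simp only [AddMonoidAlgebra.coeff_neg, Finsupp.neg_apply] at h
  simp only [AddMonoidAlgebra.coeff_zero, Finsupp.zero_apply]
  omega

theorem bialternant_mul_wgfRestrict (hν : ν = ∑ j : J, (n j : ℝ) • fundWeight b J j)
    (hstr : IsStructured b C J) (hinv : IsWeylInvariant b J (restrict b J (wgf b C)))
    (hK : ∀ x : {x // x ∉ S}, ∃ l, l + (n (κ x) + 1) = C.compLength (κ x) x ∧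
      IsRankReversible (C.sameColored κ x) (C.compRank (κ x)) l) :
    bialternant b J ν * wgfRestrict b C J = ∑ s ∈ S, bialternant b J (ν + wt b C J s) := by
  classical
  have h0 : alternant b J (ν + weylVector b J) * restrict b J (wgf b C) =
      ∑ s ∈ S, alternant b J (ν + wt b C J s + weylVector b J) := by
    rw [restrict_wgf] at hinv ⊢
    rw [alternant_mul _ _ hinv, ← Finset.sum_add_sum_compl S]
    simp only [add_right_comm ν (weylVector b J)]
    have h1 := sum_alternant_compl_eq_zero hν hstr hK
    rw [← Finset.sum_subtype Sᶜ (fun x => Finset.mem_compl)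
      (fun x => alternant b J (ν + wt b C J x + weylVector b J))] at h1
    rw [h1, add_zero]
  simp only [bialternant, wgfRestrict]
  rw [div_mul_eq_mul_div, ← map_mul, h0, map_sum, Finset.sum_div]

end Splitting

end Weights

end

end SplittingPoset

theorem theorem8p1 {ι V N R : Type*} [Finite ι]
    [AddCommGroup V] [Module ℝ V] [AddCommGroup N] [Module ℝ N]
    (P : RootPairing ι ℝ V N) [P.IsRootSystem] [P.IsCrystallographic] [P.IsReduced] (b : P.Base)
    [PartialOrder R] [Fintype R] (C : ColoredRankedPoset b.support R)
    (J : Finset b.support) (ν : V) (n : J → ℕ)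
    (hν : ν = ∑ j : J, (n j : ℝ) • fundWeight b J j)
    (hstr : IsStructured b C J) :
    -- rank symmetric `j`-components guarantee the invariance that is assumed below
    ((∀ j ∈ J, C.RankSymmetricComps j) → IsWeylInvariant b J (restrict b J (wgf b C))) ∧
    (IsWeylInvariant b J (restrict b J (wgf b C)) →
      ∀ S : Finset R, (∀ x ∈ S, ∀ j : J, C.compDepth j x ≤ n j) →
      ∀ κ : {x // x ∉ S} → J,
        -- the criterion with symmetric chain decompositions
        ((∀ x : {x // x ∉ S}, ∃ l : ℕ, l + (n (κ x) + 1) = C.compLength (κ x) x ∧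
            C.IsRankFunctionOn (κ x) (C.sameColored κ x) (C.compRank (κ x)) l ∧
            ∃ chains : Set (Set R),
              C.IsSCD (κ x) (C.sameColored κ x) (C.compRank (κ x)) l chains ∧
              ∃ c ∈ chains, ColoredRankedPoset.chainLength c = l) →
          (∀ s ∈ S, ν + wt b C J s ∈ dominantWeights b J) ∧
          bialternant b J ν * wgfRestrict b C J = ∑ s ∈ S, bialternant b J (ν + wt b C J s) ∧
          (IsStructured b C Finset.univ → IsRefinedSplitting b C J ν S)) ∧
        -- the criterion with sub-blocks of chain products
        ((∀ x : {x // x ∉ S}, C.IsSubBlock (κ x) x (n (κ x) + 1) (C.sameColored κ x)) →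
          (∀ s ∈ S, ν + wt b C J s ∈ dominantWeights b J) ∧
          bialternant b J ν * wgfRestrict b C J = ∑ s ∈ S, bialternant b J (ν + wt b C J s) ∧
          (IsStructured b C Finset.univ → IsRefinedSplitting b C J ν S)) ∧
        -- the criterion with sub-faces, for `J = I` and `ν = 0`
        (J = Finset.univ → ν = 0 →
          (∀ x : {x // x ∉ S}, C.IsSubFace (κ x) x (C.sameColored κ x)) →
          (∀ s ∈ S, wt b C J s ∈ dominantWeights b J) ∧
          IsRefinedSplitting b C J 0 S ∧
          wgfRestrict b C J = ∑ s ∈ S, bialternant b J (wt b C J s))) := by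
  have hdom : ∀ S : Finset R, (∀ x ∈ S, ∀ j : J, C.compDepth j x ≤ n j) →
      ∀ s ∈ S, ν + wt b C J s ∈ dominantWeights b J :=
    fun S hS s hs => add_wt_mem_dominantWeights hν (hS s hs)
  have hblock : ∀ (S : Finset R) (κ : {x // x ∉ S} → J),
      (∀ x : {x // x ∉ S}, C.IsSubBlock (κ x) x (n (κ x) + 1) (C.sameColored κ x)) →
      ∀ x : {x // x ∉ S}, ∃ l, l + (n (κ x) + 1) = C.compLength (κ x) x ∧
        IsRankReversible (C.sameColored κ x) (C.compRank (κ x)) l :=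
    fun S κ h x =>
      (h x).isRankReversible ⟨x, ColoredRankedPoset.mem_sameColored_self κ x⟩
  refine ⟨hstr.isWeylInvariant, fun hinv S hS κ => ⟨fun h => ?_, fun h => ?_, ?_⟩⟩
  · have hid := bialternant_mul_wgfRestrict hν hstr hinv fun x => by
      obtain ⟨l, hl, -, chains, hscd, -⟩ := h x
      exact ⟨l, hl, hscd.isRankReversible fun y hy => hy.1⟩
    exact ⟨hdom S hS, hid, fun hI => ⟨hI, hdom S hS, hid⟩⟩
  · have hid := bialternant_mul_wgfRestrict hν hstr hinv (hblock S κ h)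
    exact ⟨hdom S hS, hid, fun hI => ⟨hI, hdom S hS, hid⟩⟩
  · rintro rfl rfl h
    have hn : ∀ j, n j = 0 := fun j => by
      have := coroot_sum_fundWeight b (fun j => (n j : ℝ)) j
      rw [← hν, map_zero] at this
      exact_mod_cast this.symm
    have hid := bialternant_mul_wgfRestrict hν hstr hinv
      (hblock S κ fun x => by rw [hn]; exact h x)
    have hdom' := hdom S hS
    refine ⟨by simpa only [zero_add] using hdom', ⟨hstr, hdom', hid⟩, ?_⟩
    have h1 : bialternant b Finset.univ (0 : V) = 1 := by
      rw [bialternant, zero_add]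
      exact div_self <| (map_ne_zero_iff _ (IsFractionRing.injective _ _)).mpr
        (alternant_weylVector_ne_zero b _)
    simpa only [h1, one_mul, zero_add] using hid
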